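/- Let $k$ be a perfect field of characteristic $p>0$, let $n\ge 0$, and let $R=k[x_1,\dots,x_n]$ or $R=k[[x_1,\dots,x_n]]$. For $e\ge 1$ and an ideal $J\subseteq R$ let $I_e(J)$ be the smallest ideal $I$ of $R$ with $J\subseteq I^{[p^e]}$, where $I^{[p^e]}$ is the ideal generated by the elements $x^{p^e}$, $x\in I$. For a real number $t\ge 0$ let $\tau(J^t)=\bigcup_{e\ge 1} I_e\big(J^{\lceil tp^e\rceil}\big)$. A real number $c>0$ is an $F$-jumping coefficient of $f\in R$ if $\tau((f)^c)\subsetneq\tau((f)^{c'})$ for all $0\le c'<c$. Let $f\in R$ be nonzero with at most isolated singularities, that is, every prime ideal of $R/(f)$ at which the local ring is not regular is a maximal ideal, and let $\mathrm{Jac}(f)=\left(f,\frac{\partial f}{\partial x_1},\dots,\frac{\partial f}{\partial x_n}\right)$. Then $\dim_k(R/\mathrm{Jac}(f))$ is finite, and $f$ has at most $\dim_k(R/\mathrm{Jac}(f))+1$ $F$-jumping coefficients in $[0,1]$. -/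

import Mathlib

namespace FJump

/-- The Frobenius power `I^[p^e]`: the ideal generated by all `x ^ (p ^ e)` with `x` in `I`. -/
def frobeniusPower {R : Type*} [CommRing R] (p : ℕ) (I : Ideal R) (e : ℕ) : Ideal R :=
  Ideal.span ((fun x : R => x ^ (p ^ e)) '' (I : Set R))

/-- `I_e(J)`: the smallest ideal `I` with `J ⊆ I^[p^e]`, taken as the intersection of all such
ideals; in an `F`-finite regular ring this intersection is itself such an ideal. -/
def frobeniusRoot {R : Type*} [CommRing R] (p : ℕ) (e : ℕ) (J : Ideal R) : Ideal R :=
  sInf {I : Ideal R | J ≤ frobeniusPower p I e}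

/-- The generalized test ideal `τ(J^t)`, for `t ≥ 0`: the union over all positive integers `e` of
the ideals `I_e(J ^ ⌈t * p ^ e⌉)`. The union is taken as a supremum of ideals; for principal `J`
in an `F`-finite regular ring the family is an ascending chain, so the two coincide. -/
noncomputable def testIdeal {R : Type*} [CommRing R] (p : ℕ) (J : Ideal R) (t : ℝ) : Ideal R :=
  ⨆ (e : ℕ) (_ : 1 ≤ e), frobeniusRoot p e (J ^ ⌈t * (p : ℝ) ^ e⌉₊)

/-- `c` is an `F`-jumping coefficient of `J`: a positive real number with
`τ(J^c) ⊊ τ(J^c')` for every `0 ≤ c' < c`. -/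
def IsFJumpingCoefficient {R : Type*} [CommRing R] (p : ℕ) (J : Ideal R) (c : ℝ) : Prop :=
  0 < c ∧ ∀ c' : ℝ, 0 ≤ c' → c' < c → testIdeal p J c < testIdeal p J c'

/-- The hypersurface ring `R/(f)` has (at most) isolated singularities: every prime at which the
local ring of `R/(f)` is not regular is a maximal ideal. -/
def HasIsolatedSingularity {R : Type*} [CommRing R] (f : R) : Prop :=
  ∀ (P : Ideal (R ⧸ Ideal.span {f})) [P.IsPrime],
    ¬ IsRegularLocalRing (Localization.AtPrime P) → P.IsMaximal

/-- `Jac(f) = (f, ∂f/∂x_1, …, ∂f/∂x_n)` in `k[x_1,…,x_n]`. -/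
noncomputable def polyJac {k : Type*} [Field k] {n : ℕ} (f : MvPolynomial (Fin n) k) :
    Ideal (MvPolynomial (Fin n) k) :=
  Ideal.span (insert f (Set.range fun i : Fin n => MvPolynomial.pderiv i f))

/-- `Jac(f) = (f, ∂f/∂x_1, …, ∂f/∂x_n)` in `k[[x_1,…,x_n]]`. -/
noncomputable def seriesJac {k : Type*} [Field k] {n : ℕ} (f : MvPowerSeries (Fin n) k) :
    Ideal (MvPowerSeries (Fin n) k) :=
  Ideal.span (insert f (Set.range fun i : Fin n => MvPowerSeries.pderiv k i f))

end FJump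

/-! The key inclusion is `Jac(f) ⊆ τ(f^c)` for every `c < 1` (`le_testIdeal`). Each jump strictly
increases the colength of the test ideal, so the jumps below `1` have distinct colengths between `1`
and `dim R/Jac(f)`; the possible jump at `1` accounts for the extra one (`encard_jumping_le`).

For the inclusion, take `q = p^e` large and `I` with `f^(q-1) ∈ I^[q]`. Under `x_i ↦ x_i + t`, the
coefficients of the expansion of `f^(q-1)` below `t^q` stay in `I^[q]`. The `t^q` coefficient of the
expansion of `f^q` is `(∂_i f)^q`, and a derivative formally divided by `q` expresses it through
those lower coefficients. A Frobenius splitting then extracts `∂_i f ∈ I`.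

Finiteness is a Jacobian criterion. At a prime `P ⊇ Jac(f)`, a coefficient field of `R_P/m^2` gives
a derivation `b ↦ b - s(b)`; the chain rule evaluates it to zero on `f`, whence `f ∈ m^2`. So
`R_P/(f)` is not regular and `P` is maximal. The chain rule holds for all additive Leibniz maps
because these kill `p`-th powers and `k` is perfect. -/

namespace FJump

/-! ### Taylor coefficients, Frobenius powers and the count of jumps -/

open PowerSeries

/-- Dividing the derivative of `F ^ q` by `q`, in any commutative ring. -/
theorem coeff_pow_self_eq {R : Type*} [CommRing R] (F : PowerSeries R) (q : ℕ) (hq : q ≠ 0) :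
    coeff q (F ^ q) = coeff (q - 1) (derivative R F * F ^ (q - 1)) := by
  -- Division by `q` fails in `R`, so the identity is proved for a generic series over a domain of
  -- characteristic zero, if `R` has one; the integral polynomial identity is then specialized along
  -- `π`.
  let G : PowerSeries (MvPolynomial R ℤ) := PowerSeries.mk fun n => MvPolynomial.X (coeff n F)
  let π : MvPolynomial R ℤ →+* R := (MvPolynomial.aeval (R := ℤ) (id : R → R)).toRingHom
  have hG : PowerSeries.map π G = F := by
    ext n
    simp [G, π]
  have hdG : PowerSeries.map π (derivative _ G) = derivative R F := by
    ext n
    simp [coeff_derivative, G, π]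
  have key : coeff q (G ^ q) = coeff (q - 1) (derivative _ G * G ^ (q - 1)) := by
    have h1 := congrArg (coeff (q - 1)) (derivative_pow G q)
    rw [coeff_derivative, Nat.sub_add_cancel (Nat.pos_of_ne_zero hq),
      mul_assoc, ← map_natCast (C (R := MvPolynomial R ℤ)) q, coeff_C_mul] at h1
    have h2 : ((q - 1 : ℕ) : MvPolynomial R ℤ) + 1 = q := by
      rw [← Nat.cast_add_one, Nat.sub_add_cancel (Nat.pos_of_ne_zero hq)]
    rw [h2, mul_comm] at h1
    have h3 : (q : MvPolynomial R ℤ) ≠ 0 := Nat.cast_ne_zero.mpr hq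
    rw [mul_left_cancel₀ h3 h1, mul_comm]
  have := congrArg π key
  rwa [← PowerSeries.coeff_map, ← PowerSeries.coeff_map, map_mul, map_pow (PowerSeries.map π),
    map_pow (PowerSeries.map π), hG, hdG] at this

theorem coeff_pow_expChar_pow {R : Type*} [CommRing R] (p : ℕ) [Fact p.Prime] [CharP R p]
    (F : PowerSeries R) (e : ℕ) :
    coeff (p ^ e) (F ^ p ^ e) = (coeff 1 F) ^ p ^ e := by
  have hq : 0 < p ^ e := pow_pos (Fact.out : p.Prime).pos _
  have : CharP R⟦X⟧ p := charP_of_injective_algebraMap (R := R) (A := R⟦X⟧) C_injective p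
  obtain ⟨G, hG⟩ : X ^ 2 ∣ F - (C (coeff 0 F) + C (coeff 1 F) * X) := by
    rw [X_pow_dvd_iff]
    intro m hm
    interval_cases m <;> simp [coeff_C]
  have hF : F = C (coeff 0 F) + C (coeff 1 F) * X + X ^ 2 * G := by rw [← hG]; ring
  have hF' : F ^ p ^ e = C (coeff 0 F ^ p ^ e) + C (coeff 1 F ^ p ^ e) * X ^ p ^ e
      + X ^ (2 * p ^ e) * G ^ p ^ e := by
    conv_lhs => rw [hF]
    rw [add_pow_char_pow, add_pow_char_pow, mul_pow, mul_pow, map_pow C, map_pow C, ← pow_mul]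
  rw [hF', map_add, map_add, coeff_C, if_neg hq.ne', coeff_C_mul, coeff_X_pow_self,
    coeff_X_pow_mul', if_neg (by omega)]
  simp

section Frobenius

variable {R : Type*} [CommRing R] (p : ℕ) [Fact p.Prime] [CharP R p]

/-- A Taylor expansion preserves Frobenius powers in low degrees. -/
theorem coeff_mem_frobeniusPower (Φ : R →+* R⟦X⟧) (hΦ : ∀ r, coeff 0 (Φ r) = r)
    (I : Ideal R) (e : ℕ) {y : R} (hy : y ∈ frobeniusPower p I e) :
    ∀ j < p ^ e, coeff j (Φ y) ∈ frobeniusPower p I e := by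
  have : CharP R⟦X⟧ p := charP_of_injective_algebraMap (R := R) (A := R⟦X⟧) C_injective p
  have hq : p ^ e ≠ 0 := pow_ne_zero _ (Fact.out : p.Prime).ne_zero
  refine Submodule.span_induction ?_ ?_ ?_ ?_ hy
  · rintro _ ⟨s, hs, rfl⟩ j hj
    have hs' : s ^ p ^ e ∈ frobeniusPower p I e := Ideal.subset_span ⟨s, hs, rfl⟩
    obtain ⟨G, hG⟩ : X ∣ Φ s - C s := by
      rw [X_dvd_iff, ← coeff_zero_eq_constantCoeff_apply, map_sub, hΦ, coeff_zero_C, sub_self]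
    have hF : Φ s = C s + X * G := by rw [← hG]; ring
    simp only [map_pow, hF, add_pow_char_pow, mul_pow, map_add]
    rw [coeff_X_pow_mul', if_neg (by omega), ← map_pow, coeff_C, add_zero]
    split_ifs
    · exact hs'
    · exact zero_mem _
  · intro j _; simp
  · intro x y _ _ hx hy j hj
    rw [map_add, map_add]; exact add_mem (hx j hj) (hy j hj)
  · intro a x _ hx j hj
    rw [smul_eq_mul, map_mul, coeff_mul]
    refine Ideal.sum_mem _ fun b hb => Ideal.mul_mem_left _ _ (hx _ ?_)
    have := Finset.HasAntidiagonal.mem_antidiagonal.mp hb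
    omega

/-- The `t^q` coefficient of `Φ(f)^q` is also the `t^(q-1)` coefficient of `Φ(f)' * Φ(f^(q-1))`,
which involves only coefficients of `Φ(f^(q-1))` of degree less than `q`. -/
theorem coeff_one_pow_mem_frobeniusPower (Φ : R →+* R⟦X⟧) (hΦ : ∀ r, coeff 0 (Φ r) = r)
    (I : Ideal R) (e : ℕ) {f : R} (hf : f ^ (p ^ e - 1) ∈ frobeniusPower p I e) :
    (coeff 1 (Φ f)) ^ p ^ e ∈ frobeniusPower p I e := by
  have hq : p ^ e ≠ 0 := pow_ne_zero _ (Fact.out : p.Prime).ne_zero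
  rw [← coeff_pow_expChar_pow, coeff_pow_self_eq _ _ hq, coeff_mul, ← map_pow]
  refine Ideal.sum_mem _ fun b hb => Ideal.mul_mem_left _ _
    (coeff_mem_frobeniusPower p Φ hΦ I e hf _ ?_)
  have := Finset.HasAntidiagonal.mem_antidiagonal.mp hb
  omega


-- The iterate `φ^[e]` is additive with `φ^[e] (r * s^q) = s * φ^[e] r`, so it carries `I^[q]` into
-- `I` and `r^q` to `r`.
omit [Fact p.Prime] [CharP R p] in
theorem mem_of_pow_mem_frobeniusPower (φ : R →+ R) (hφ : ∀ r s, φ (r * s ^ p) = s * φ r)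
    (hφ1 : φ 1 = 1) (I : Ideal R) (e : ℕ) {r : R} (hr : r ^ p ^ e ∈ frobeniusPower p I e) :
    r ∈ I := by
  have iter : ∀ e r s, φ^[e] (r * s ^ p ^ e) = s * φ^[e] r := by
    intro e
    induction e with
    | zero => intro r s; simp [mul_comm]
    | succ e ih =>
      intro r s
      rw [Function.iterate_succ_apply', pow_succ', mul_comm p, pow_mul, ← pow_mul, mul_comm (p ^ e),
        pow_mul, ih, mul_comm, hφ, Function.iterate_succ_apply']
  have iter1 : ∀ e, φ^[e] 1 = 1 := fun e => Function.iterate_fixed hφ1 e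
  have hadd : ∀ e x y, φ^[e] (x + y) = φ^[e] x + φ^[e] y := fun e => iterate_map_add φ e
  have hmem : ∀ y ∈ frobeniusPower p I e, φ^[e] y ∈ I := by
    intro y hy
    -- `φ^[e]` is not `R`-linear, so induction runs over sums of multiples `a * s^q` rather than
    -- over the linear span.
    rw [frobeniusPower, Ideal.span, ← Submodule.mem_toAddSubmonoid] at hy
    refine Submodule.closure_induction (p := fun y _ => φ^[e] y ∈ I) ?_ ?_ ?_ hy
    · simp
    · intro x y _ _ hx hy
      rw [hadd]; exact add_mem hx hy
    · rintro a _ ⟨s, hs, rfl⟩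
      rw [smul_eq_mul, iter]
      exact I.mul_mem_right _ hs
  have := hmem _ hr
  rwa [← one_mul (r ^ _), iter, iter1, mul_one] at this


/-- The first-order Taylor coefficients of `f` lie in all the test ideals `τ(f ^ c)`, `c < 1`. -/
theorem le_testIdeal {ι : Type*} (Φ : ι → R →+* R⟦X⟧)
    (hΦ : ∀ i r, coeff 0 (Φ i r) = r)
    (φ : R →+ R) (hφ : ∀ r s, φ (r * s ^ p) = s * φ r) (hφ1 : φ 1 = 1) (f : R)
    {c : ℝ} (hc : c < 1) :
    Ideal.span (insert f (Set.range fun i => coeff 1 (Φ i f))) ≤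
      testIdeal p (Ideal.span {f}) c := by
  have hp : 1 < (p : ℝ) := by exact_mod_cast (Fact.out : p.Prime).one_lt
  -- Once `p^e (1 - c) > 1`, the exponent `⌈c p^e⌉` is at most `p^e - 1`. Passing to `e + 1` keeps
  -- this and makes the index positive.
  obtain ⟨e, he⟩ := pow_unbounded_of_one_lt (1 / (1 - c)) hp
  have hc' : 0 < 1 - c := by linarith
  set e' := e + 1
  have he' : (1 / (1 - c)) < (p : ℝ) ^ e' :=
    he.trans (pow_lt_pow_right₀ hp (Nat.lt_succ_self e))
  have hq : 1 ≤ p ^ e' := Nat.one_le_pow _ _ (Fact.out : p.Prime).pos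
  have hceil : ⌈c * (p : ℝ) ^ e'⌉₊ ≤ p ^ e' - 1 := by
    rw [Nat.ceil_le]
    push_cast [hq]
    rw [div_lt_iff₀ hc'] at he'
    linarith
  refine le_trans ?_ (le_iSup₂_of_le (f := fun (e : ℕ) (_ : 1 ≤ e) =>
    frobeniusRoot p e (Ideal.span {f} ^ ⌈c * (p : ℝ) ^ e⌉₊)) e' (Nat.le_add_left 1 e) le_rfl)
  refine le_sInf fun I hI => ?_
  have hf : f ^ (p ^ e' - 1) ∈ frobeniusPower p I e' :=
    hI (Ideal.pow_le_pow_right hceil (Ideal.pow_mem_pow (Ideal.mem_span_singleton_self f) _))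
  rw [Ideal.span_le]
  rintro _ (rfl | ⟨i, rfl⟩)
  · refine mem_of_pow_mem_frobeniusPower p φ hφ hφ1 I e' ?_
    rw [← Nat.sub_add_cancel hq, pow_succ]
    exact Ideal.mul_mem_right _ _ hf
  · exact mem_of_pow_mem_frobeniusPower p φ hφ hφ1 I e'
      (coeff_one_pow_mem_frobeniusPower p (Φ i) (hΦ i) I e' hf)

end Frobenius

theorem finrank_quotient_lt {k R : Type*} [Field k] [CommRing R] [Algebra k R] {I J : Ideal R}
    (h : I < J) [Module.Finite k (R ⧸ I)] :
    Module.finrank k (R ⧸ J) < Module.finrank k (R ⧸ I) := by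
  let π : (R ⧸ I) →ₗ[k] (R ⧸ J) := (Ideal.Quotient.factorₐ k h.le).toLinearMap
  have hπ : Function.Surjective π := Ideal.Quotient.factor_surjective h.le
  have h1 := LinearMap.finrank_range_add_finrank_ker π
  rw [LinearMap.range_eq_top.mpr hπ, finrank_top] at h1
  obtain ⟨x, hxJ, hxI⟩ := SetLike.exists_of_lt h
  have : 0 < Module.finrank k (LinearMap.ker π) := by
    rw [Module.finrank_pos_iff_exists_ne_zero]
    refine ⟨⟨Ideal.Quotient.mk I x, ?_⟩, ?_⟩
    · exact Ideal.Quotient.eq_zero_iff_mem.mpr hxJ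
    · intro h0
      exact hxI (Ideal.Quotient.eq_zero_iff_mem.mp (congrArg Subtype.val h0))
  omega

/-- A lower bound of finite colength for the test ideals bounds the number of jumps. -/
theorem encard_jumping_le {k R : Type*} [Field k] [CommRing R] [Algebra k R] (p : ℕ)
    (J K : Ideal R) [Module.Finite k (R ⧸ K)]
    (hK : ∀ c : ℝ, c < 1 → K ≤ testIdeal p J c) :
    Set.encard {c : ℝ | c ∈ Set.Icc (0 : ℝ) 1 ∧ IsFJumpingCoefficient p J c} ≤
      ((Module.finrank k (R ⧸ K) + 1 : ℕ) : ℕ∞) := by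
  set d := Module.finrank k (R ⧸ K)
  set S := {c : ℝ | c < 1 ∧ IsFJumpingCoefficient p J c}
  have hfin : ∀ c : ℝ, c < 1 → Module.Finite k (R ⧸ testIdeal p J c) := fun c hc =>
    Module.Finite.of_surjective (Ideal.Quotient.factorₐ k (hK c hc)).toLinearMap
      (Ideal.Quotient.factor_surjective (hK c hc))
  have hlt : ∀ c' c : ℝ, 0 ≤ c' → c' < c → c ∈ S →
      Module.finrank k (R ⧸ testIdeal p J c') < Module.finrank k (R ⧸ testIdeal p J c) := by
    intro c' c h0 h hc
    have := hfin c hc.1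
    exact finrank_quotient_lt (hc.2.2 c' h0 h)
  have hmaps : Set.MapsTo (fun c => Module.finrank k (R ⧸ testIdeal p J c)) S
      (Finset.Icc 1 d : Finset ℕ) := by
    intro c hc
    -- Comparison with exponent `0` excludes colength zero, leaving `d` possible values instead of
    -- `d + 1`.
    have h1 := hlt 0 c le_rfl hc.2.1 hc
    have h2 : Module.finrank k (R ⧸ testIdeal p J c) ≤ d :=
      LinearMap.finrank_le_finrank_of_surjective
        (f := (Ideal.Quotient.factorₐ k (hK c hc.1)).toLinearMap)
        (Ideal.Quotient.factor_surjective (hK c hc.1))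
    simp only [Finset.coe_Icc, Set.mem_Icc]
    exact ⟨by omega, h2⟩
  have hinj : Set.InjOn (fun c => Module.finrank k (R ⧸ testIdeal p J c)) S := by
    intro a ha b hb hab
    rcases lt_trichotomy a b with h | h | h
    · exact absurd hab (hlt a b ha.2.1.le h hb).ne
    · exact h
    · exact absurd hab (hlt b a hb.2.1.le h ha).ne'
  have hS : S.encard ≤ d := by
    refine (Set.encard_le_encard_of_injOn hmaps hinj).trans ?_
    rw [Set.encard_coe_eq_coe_finsetCard, Nat.card_Icc, Nat.add_sub_cancel]
  have hsub : {c : ℝ | c ∈ Set.Icc (0 : ℝ) 1 ∧ IsFJumpingCoefficient p J c} ⊆ insert 1 S := by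
    rintro c ⟨⟨_, h1⟩, hc⟩
    rcases h1.lt_or_eq with h | h
    · exact Or.inr ⟨h, hc⟩
    · exact Or.inl h
  refine (Set.encard_le_encard hsub).trans ((Set.encard_insert_le _ _).trans ?_)
  push_cast
  gcongr

end FJump

/-! ### Coefficient fields and the Jacobian criterion -/

namespace FJump

open IsLocalRing

section CoefficientField

open Polynomial

variable {B : Type*} [CommRing B] [IsLocalRing B] (p : ℕ) [Fact p.Prime] [CharP B p]

/-- In characteristic `p`, a subring containing all `p`-th powers and maximal among those that meet
the maximal ideal trivially is a coefficient field. -/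
theorem exists_sub_mem_maximalIdeal_of_maximal {S : Subring B}
    (hS : Maximal (fun S : Subring B => (frobenius B p).range ≤ S ∧
      ∀ b ∈ S, b ∈ maximalIdeal B → b = 0) S) (y : B) :
    ∃ s ∈ S, y - s ∈ maximalIdeal B := by
  by_contra! hy
  have hpow : ∀ b : B, b ^ p ∈ S := fun b => hS.prop.1 ⟨b, rfl⟩
  have hfield : IsField S := by
    refine ⟨⟨0, 1, zero_ne_one⟩, mul_comm, ?_⟩
    intro a ha
    have hu : IsUnit (a : B) := by
      by_contra h
      exact ha (Subtype.ext (hS.prop.2 a a.2 ((mem_maximalIdeal _).mpr h)))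
    obtain ⟨b, hb⟩ := hu.exists_right_inv
    -- The inverse `b` of `a` in `B` need not visibly lie in `S`, but `a⁻¹ = a^(p-1) * b^p` does,
    -- since `S` contains all `p`-th powers.
    refine ⟨a ^ (p - 1) * ⟨b ^ p, hpow b⟩, Subtype.ext ?_⟩
    have : (a : B) * ((a : B) ^ (p - 1) * b ^ p) = 1 := by
      rw [← mul_assoc, ← pow_succ', Nat.sub_add_cancel (Fact.out : p.Prime).one_lt.le, ← mul_pow,
        hb, one_pow]
    simpa using this
  let : Field S := hfield.toField
  let : Algebra S (ResidueField B) := ((residue B).comp S.subtype).toAlgebra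
  have hres : ∀ g : S[X], residue B (aeval y g) = aeval (residue B y) g := by
    intro g
    rw [aeval_def, aeval_def, hom_eval₂]
    rfl
  let a : S := ⟨y ^ p, hpow y⟩
  -- A root `b ∈ S` of `X^p - y^p` would satisfy `(y - b)^p = 0`, hence `y - b ∈ m`, against the
  -- choice of `y`.
  have hirr : Irreducible (X ^ p - C a) := by
    refine X_pow_sub_C_irreducible_of_prime (Fact.out : p.Prime) fun b hb => hy b b.2 ?_
    have h1 : (b : B) ^ p = y ^ p := congrArg Subtype.val hb
    rw [← residue_eq_zero_iff, ← pow_eq_zero_iff (Fact.out : p.Prime).ne_zero, ← map_pow,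
      sub_pow_char, h1, sub_self, map_zero]
  have hmin : minpoly S (residue B y) = X ^ p - C a := by
    refine (minpoly.eq_of_irreducible_of_monic hirr ?_
      (monic_X_pow_sub_C a (Fact.out : p.Prime).ne_zero)).symm
    rw [← hres, map_sub, map_pow, aeval_X, aeval_C]
    exact (congrArg _ (sub_self _)).trans (map_zero _)
  let S' : Subring B := (aeval y : S[X] →ₐ[S] B).toRingHom.range
  have hSS' : S ≤ S' := by
    intro b hb
    refine ⟨C ⟨b, hb⟩, ?_⟩
    exact aeval_C y _
  -- If `g(y) ∈ m`, the minimal polynomial `X^p - y^p` divides `g`. Since it vanishes at `y` in `B`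
  -- itself, not only modulo `m`, also `g(y) = 0`; thus `S[y]` contradicts maximality.
  have hS' : (frobenius B p).range ≤ S' ∧ ∀ b ∈ S', b ∈ maximalIdeal B → b = 0 := by
    refine ⟨hS.prop.1.trans hSS', ?_⟩
    rintro _ ⟨g, rfl⟩ hg
    have hg' : aeval (residue B y) g = 0 := by
      rw [← hres]; exact (residue_eq_zero_iff _).mpr hg
    have hdvd := minpoly.dvd S _ hg'
    rw [hmin] at hdvd
    obtain ⟨h, rfl⟩ := hdvd
    change aeval y ((X ^ p - C a) * h) = 0
    rw [map_mul, map_sub, map_pow, aeval_X, aeval_C]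
    have : y ^ p - algebraMap S B a = 0 := sub_self _
    rw [this, zero_mul]
  have hyS : y ∈ S := hS.le_of_ge hS' hSS' ⟨X, aeval_X y⟩
  exact hy y hyS (by simp)

-- As `m^2 = 0` and `p ≥ 2`, `p`-th powers of elements of `m` vanish, so the image of Frobenius
-- meets `m` trivially and Zorn's lemma starts there. The maximal subring maps isomorphically to the
-- residue field, and `s` is the induced retraction.
include p in
theorem exists_ringHom_section_residue (hm : maximalIdeal B ^ 2 = ⊥) :
    ∃ s : B →+* B, (∀ b ∈ maximalIdeal B, s b = 0) ∧ ∀ b, b - s b ∈ maximalIdeal B := by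
  have hsq : ∀ b ∈ maximalIdeal B, b ^ p = 0 := fun b hb => by
    have : b ^ 2 = 0 := by
      rw [← Ideal.mem_bot, ← hm]; exact Ideal.pow_mem_pow hb 2
    exact pow_eq_zero_of_le (Fact.out : p.Prime).two_le this
  obtain ⟨S, -, hS⟩ := zorn_le_nonempty₀
    {S : Subring B | (frobenius B p).range ≤ S ∧ ∀ b ∈ S, b ∈ maximalIdeal B → b = 0} (by
      intro c hc hchain T hT
      have hdir : DirectedOn (· ≤ ·) c := hchain.directedOn
      refine ⟨sSup c, ⟨(hc hT).1.trans (le_sSup hT), ?_⟩, fun _ => le_sSup⟩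
      intro b hb
      obtain ⟨U, hU, hbU⟩ := (Subring.mem_sSup_of_directedOn ⟨T, hT⟩ hdir).mp hb
      exact (hc hU).2 b hbU) (frobenius B p).range ⟨le_rfl, by
      rintro _ ⟨b, rfl⟩ hb
      exact hsq b ((inferInstance : (maximalIdeal B).IsPrime).mem_of_pow_mem p hb)⟩
  have hbij : Function.Bijective ((residue B).comp S.subtype) := by
    constructor
    · rw [injective_iff_map_eq_zero]
      intro b hb
      exact Subtype.ext (hS.prop.2 b b.2 ((residue_eq_zero_iff _).mp hb))
    · intro z
      obtain ⟨y, rfl⟩ := residue_surjective z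
      obtain ⟨s, hs, hys⟩ := exists_sub_mem_maximalIdeal_of_maximal p hS y
      refine ⟨⟨s, hs⟩, ?_⟩
      have := (residue_eq_zero_iff _).mpr hys
      rw [map_sub, sub_eq_zero] at this
      exact this.symm
  let e := RingEquiv.ofBijective _ hbij
  refine ⟨S.subtype.comp (e.symm.toRingHom.comp (residue B)), ?_, ?_⟩
  · intro b hb
    simp [(residue_eq_zero_iff b).mpr hb]
  · intro b
    rw [← residue_eq_zero_iff, map_sub, sub_eq_zero]
    exact (e.apply_symm_apply (residue B b)).symm

end CoefficientField

universe u

/-- The Leibniz rule for an additive map. -/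
def IsLeibniz {R M : Type*} [CommRing R] [AddCommGroup M] [Module R M] (D : R →+ M) : Prop :=
  ∀ a b, D (a * b) = a • D b + b • D a

/-- The defect of the Leibniz rule for `id - s` is exactly `(a - s a) * (b - s b)`. -/
theorem exists_isLeibniz_sub_apply {R B : Type*} [CommRing R] [CommRing B] [Algebra R B]
    (s : B →+* B) (hs : ∀ b b', (b - s b) * (b' - s b') = 0) :
    ∃ D : R →+ B, IsLeibniz D ∧ ∀ r, D r = algebraMap R B r - s (algebraMap R B r) := by
  let D₀ : R →+ B := (algebraMap R B : R →+ B) - ((s.comp (algebraMap R B) : R →+* B) : R →+ B)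
  have hD₀ : ∀ r, D₀ r = algebraMap R B r - s (algebraMap R B r) := fun r => rfl
  refine ⟨D₀, fun a b => ?_, hD₀⟩
  have h1 := hs (algebraMap R B a) (algebraMap R B b)
  simp only [hD₀, Algebra.smul_def, map_mul]
  linear_combination (-1 : B) * h1

/-- Jacobian criterion: an element of a prime `P` all of whose partial derivatives lie in `P` is in
the square of the maximal ideal at `P`. -/
theorem algebraMap_mem_maximalIdeal_sq {R : Type u} [CommRing R] (p : ℕ) [Fact p.Prime] [CharP R p]
    {ι : Type*} [Fintype ι] (x : ι → R) (d : ι → R → R)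
    (hD : ∀ (M : Type u) [AddCommGroup M] [Module R M] (D : R →+ M) (r : R), IsLeibniz D →
      D r = ∑ i, d i r • D (x i))
    (P : Ideal R) [P.IsPrime] {f : R} (hf : f ∈ P) (hdf : ∀ i, d i f ∈ P) :
    algebraMap R (Localization.AtPrime P) f ∈ maximalIdeal (Localization.AtPrime P) ^ 2 := by
  set A := Localization.AtPrime P
  let B := A ⧸ maximalIdeal A ^ 2
  have hne : maximalIdeal A ^ 2 ≠ ⊤ := fun h =>
    (maximalIdeal.isMaximal A).ne_top (top_le_iff.mp (h ▸ Ideal.pow_le_self two_ne_zero))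
  have : Nontrivial B := Ideal.Quotient.nontrivial_iff.mpr hne
  have : IsLocalRing B := IsLocalRing.of_surjective' (Ideal.Quotient.mk _)
    Ideal.Quotient.mk_surjective
  have hmap : maximalIdeal B = (maximalIdeal A).map (Ideal.Quotient.mk (maximalIdeal A ^ 2)) :=
    (map_maximalIdeal_of_surjective _ Ideal.Quotient.mk_surjective).symm
  have hsq : maximalIdeal B ^ 2 = ⊥ := by
    rw [hmap, ← Ideal.map_pow, Ideal.map_quotient_self]
  have hchar : CharP B p := by
    have h0 : ((p : ℕ) : B) = 0 := by
      have := congrArg (algebraMap R B) (CharP.cast_eq_zero R p)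
      rwa [map_natCast, map_zero] at this
    exact (CharP.charP_iff_prime_eq_zero Fact.out).mpr h0
  have hm0 : ∀ a b : B, a ∈ maximalIdeal B → b ∈ maximalIdeal B → a * b = 0 := fun a b ha hb => by
    have := Ideal.mul_mem_mul ha hb
    rwa [← sq, hsq] at this
  obtain ⟨s, hs0, hs⟩ := exists_ringHom_section_residue p hsq
  obtain ⟨D, hDL, hDapp⟩ := exists_isLeibniz_sub_apply (R := R) s fun b b' => hm0 _ _ (hs b) (hs b')
  have hmem : ∀ r ∈ P, algebraMap R B r ∈ maximalIdeal B := by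
    intro r hr
    rw [hmap]
    refine Ideal.mem_map_of_mem _ ?_
    rw [← Localization.AtPrime.map_eq_maximalIdeal]
    exact Ideal.mem_map_of_mem _ hr
  have key := hD B D f hDL
  -- `s` kills the image of `f`, so `D f` is that image; each term of the chain rule is a product of
  -- two elements of `m`, hence zero.
  rw [hDapp, hs0 _ (hmem f hf), sub_zero, Finset.sum_eq_zero] at key
  · exact Ideal.Quotient.eq_zero_iff_mem.mp key
  · intro i _
    rw [Algebra.smul_def]
    rw [hDapp]
    exact hm0 _ _ (hmem _ (hdf i)) (hs _)

/-- Cutting a Noetherian local domain by a nonzero element of the square of the maximal ideal never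
gives a regular local ring. -/
theorem not_isRegularLocalRing_of_surjective {A C : Type*} [CommRing A] [IsLocalRing A]
    [IsNoetherianRing A] [IsDomain A] [CommRing C] (π : A →+* C) (hπ : Function.Surjective π)
    {a : A} (ha : a ≠ 0) (ham : a ∈ maximalIdeal A ^ 2) (hker : RingHom.ker π = Ideal.span {a}) :
    ¬ IsRegularLocalRing C := by
  intro hreg
  have hloc : IsLocalHom π := IsLocalHom.of_surjective _ hπ
  have hmap : (maximalIdeal A).map π = maximalIdeal C := by
    exact map_maximalIdeal_of_surjective π hπ
  have hdim : ringKrullDim C + 1 ≤ ringKrullDim A :=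
    ringKrullDim_succ_le_of_surjective π hπ (mem_nonZeroDivisors_of_ne_zero ha)
      (by rw [← RingHom.mem_ker, hker]; exact Ideal.mem_span_singleton_self a)
  -- Because `a ∈ m^2`, lifts of generators of the maximal ideal of `C` generate that of `A` modulo
  -- its square, hence generate it by Nakayama. Regularity of `C` would then give `dim C + 1 ≤ dim A
  -- ≤ dim C`, the last step through the embedding dimensions.
  have hspan : (maximalIdeal A).spanFinrank ≤ (maximalIdeal C).spanFinrank := by
    have hfg : (maximalIdeal C).FG := (maximalIdeal C).fg_of_isNoetherianRing
    obtain ⟨σ, hσ⟩ := hπ.hasRightInverse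
    set G := (maximalIdeal C).generators
    have hGfin : G.Finite := Submodule.FG.finite_generators hfg
    have hGC : Ideal.span G = maximalIdeal C := (maximalIdeal C).span_generators
    set T := σ '' G
    have hTm : Ideal.span T ≤ maximalIdeal A := by
      rw [Ideal.span_le]
      rintro _ ⟨g, hg, rfl⟩
      rw [← maximalIdeal_comap π]
      change π (σ g) ∈ maximalIdeal C
      rw [hσ g, ← hGC]
      exact Ideal.subset_span hg
    have hle : maximalIdeal A ≤ Ideal.span T ⊔ maximalIdeal A • maximalIdeal A := by
      intro b hb
      have hb' : π b ∈ (Ideal.span T).map π := by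
        rw [Ideal.map_span, ← Set.image_comp]
        have : (π ∘ σ) '' G = G := by
          rw [show π ∘ σ = id from funext hσ, Set.image_id]
        rw [this, hGC, ← hmap]
        exact Ideal.mem_map_of_mem _ hb
      obtain ⟨t, ht, htb⟩ := (Ideal.mem_map_iff_of_surjective π hπ).mp hb'
      have hk : b - t ∈ RingHom.ker π := by rw [RingHom.mem_ker, map_sub, htb, sub_self]
      rw [hker] at hk
      rw [← sub_add_cancel b t, add_comm]
      refine Submodule.add_mem_sup ht ?_
      rw [smul_eq_mul, ← sq]
      exact (Ideal.span_singleton_le_iff_mem _).mpr ham hk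
    have hTtop : maximalIdeal A = Ideal.span T :=
      le_antisymm (Submodule.le_of_le_smul_of_le_jacobson_bot
        (maximalIdeal A).fg_of_isNoetherianRing (IsLocalRing.maximalIdeal_le_jacobson _) hle) hTm
    rw [hTtop]
    refine (Submodule.spanFinrank_span_le_ncard_of_finite (hGfin.image σ)).trans
      ((Set.ncard_image_le hGfin).trans ?_)
    rw [Submodule.FG.generators_ncard hfg]
  have h1 := (isRegularLocalRing_iff C).mp hreg
  have h2 := ringKrullDim_le_spanFinrank_maximalIdeal A
  rw [← h1] at hdim
  have h3 := hdim.trans h2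
  have h4 : (maximalIdeal C).spanFinrank + 1 ≤ (maximalIdeal A).spanFinrank := by exact_mod_cast h3
  omega

theorem isMaximal_of_jacobian_le {R : Type u} [CommRing R] [IsNoetherianRing R] [IsDomain R]
    (p : ℕ) [Fact p.Prime] [CharP R p]
    {ι : Type*} [Fintype ι] (x : ι → R) (d : ι → R → R)
    (hD : ∀ (M : Type u) [AddCommGroup M] [Module R M] (D : R →+ M) (r : R), IsLeibniz D →
      D r = ∑ i, d i r • D (x i))
    {f : R} (hf0 : f ≠ 0) (hf : HasIsolatedSingularity f) (P : Ideal R) [hP : P.IsPrime]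
    (hJ : Ideal.span (insert f (Set.range fun i => d i f)) ≤ P) : P.IsMaximal := by
  have hfP : f ∈ P := hJ (Ideal.subset_span (Set.mem_insert _ _))
  have hdP : ∀ i, d i f ∈ P := fun i => hJ (Ideal.subset_span (Or.inr ⟨i, rfl⟩))
  let π := Ideal.Quotient.mk (Ideal.span {f})
  have hπ : Function.Surjective π := Ideal.Quotient.mk_surjective
  have hkerP : RingHom.ker π ≤ P := by
    rw [Ideal.mk_ker]; exact (Ideal.span_singleton_le_iff_mem _).mpr hfP
  let Q : Ideal (R ⧸ Ideal.span {f}) := P.map π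
  have hQ : Q.IsPrime := Ideal.map_isPrime_of_surjective hπ hkerP
  have hcomap : Q.comap π = P := by
    rw [Ideal.comap_map_of_surjective π hπ, sup_eq_left]
    exact hkerP
  -- The local ring of `R/(f)` at `Q` is `R_P/(f)`: localization commutes with the quotient, and the
  -- kernel of `g` is generated by `f`.
  have hns : ¬ IsRegularLocalRing (Localization.AtPrime Q) := by
    have hsub : P.primeCompl.map π = Q.primeCompl := by
      ext z
      obtain ⟨r, rfl⟩ := hπ z
      have hr : π r ∈ Q ↔ r ∈ P := by rw [← Ideal.mem_comap, hcomap]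
      constructor
      · rintro ⟨t, ht, htr⟩
        rw [← htr]
        intro h
        have h' : t ∈ Q.comap π := h
        rw [hcomap] at h'
        exact ht h'
      · intro h
        exact ⟨r, fun h' => h (hr.mpr h'), rfl⟩
    have hloc : IsLocalization (P.primeCompl.map π) (Localization.AtPrime Q) := by
      rw [hsub]; infer_instance
    let g : Localization.AtPrime P →+* Localization.AtPrime Q :=
      IsLocalization.map (M := P.primeCompl) (T := P.primeCompl.map π) (Localization.AtPrime Q) π
        (Submonoid.le_comap_map _)
    have hg : Function.Surjective g := IsLocalization.map_surjective_of_surjective _ _ _ hπ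
    have hinj : Function.Injective (algebraMap R (Localization.AtPrime P)) :=
      IsLocalization.injective _ P.primeCompl_le_nonZeroDivisors
    have : IsDomain (Localization.AtPrime P) :=
      IsLocalization.isDomain_of_le_nonZeroDivisors _ P.primeCompl_le_nonZeroDivisors
    refine not_isRegularLocalRing_of_surjective g hg (a := algebraMap R _ f) ?_
      (algebraMap_mem_maximalIdeal_sq p x d hD P hfP hdP) ?_
    · rwa [Ne, map_eq_zero_iff _ hinj]
    · rw [IsLocalization.ker_map (Localization.AtPrime Q) _ rfl, Ideal.mk_ker, Ideal.map_span,
        Set.image_singleton]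
  have hmax : Q.IsMaximal := hf Q hns
  rw [← hcomap]
  exact Ideal.comap_isMaximal_of_surjective π hπ

end FJump

/-! ### From Taylor maps and the chain rule to the two conclusions -/

namespace FJump

universe u

theorem IsLeibniz.pow_char {R M : Type*} [CommRing R] (p : ℕ) [CharP R p] [AddCommGroup M]
    [Module R M] {D : R →+ M} (hD : IsLeibniz D) (r : R) : D (r ^ p) = 0 := by
  have := (Derivation.mk' D.toIntLinearMap hD).leibniz_pow r p
  rw [← Nat.cast_smul_eq_nsmul R, CharP.cast_eq_zero, zero_smul] at this
  exact this

/-- The first Taylor coefficient is a derivation. -/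
theorem exists_isLeibniz_coeff_one {R : Type*} [CommRing R] (Φ : R →+* PowerSeries R)
    (hΦ : ∀ r, PowerSeries.coeff 0 (Φ r) = r) :
    ∃ D : R →+ R, IsLeibniz D ∧ ∀ r, D r = PowerSeries.coeff 1 (Φ r) := by
  let D₀ : R →+ R := (PowerSeries.coeff (R := R) 1).toAddMonoidHom.comp (Φ : R →+ PowerSeries R)
  have hD₀ : ∀ r, D₀ r = PowerSeries.coeff 1 (Φ r) := fun r => rfl
  refine ⟨D₀, fun a b => ?_, hD₀⟩
  simp only [hD₀, map_mul, smul_eq_mul, PowerSeries.coeff_mul]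
  rw [Finset.Nat.antidiagonal_succ, Finset.sum_cons, Finset.Nat.antidiagonal_zero]
  simp [hΦ, mul_comm]

section Main

variable {k : Type u} [Field k] {R : Type u} [CommRing R] [Algebra k R] (p : ℕ) [Fact p.Prime] [CharP R p] {ι : Type*} [Fintype ι]
  (x : ι → R) (d : ι → R → R)
  (hD : ∀ (M : Type u) [AddCommGroup M] [Module R M] (D : R →+ M) (r : R), IsLeibniz D →
      D r = ∑ i, d i r • D (x i))

include hD

theorem encard_jumping_le_of_taylor [DecidableEq ι] (Φ : ι → R →+* PowerSeries R)
    (hΦ : ∀ i r, PowerSeries.coeff 0 (Φ i r) = r)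
    (hΦx : ∀ i j, PowerSeries.coeff 1 (Φ i (x j)) = if j = i then 1 else 0)
    (φ : R →+ R) (hφ : ∀ r s, φ (r * s ^ p) = s * φ r) (hφ1 : φ 1 = 1) (f : R)
    (hfin : Module.Finite k (R ⧸ Ideal.span (insert f (Set.range fun i => d i f)))) :
    Set.encard {c : ℝ | c ∈ Set.Icc (0 : ℝ) 1 ∧
        IsFJumpingCoefficient p (Ideal.span {f}) c} ≤
      ((Module.finrank k (R ⧸ Ideal.span (insert f (Set.range fun i => d i f))) + 1 : ℕ) : ℕ∞) := by
  refine encard_jumping_le p _ _ fun c hc => ?_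
  have hcoeff : ∀ i, PowerSeries.coeff 1 (Φ i f) = d i f := by
    intro i
    obtain ⟨D, hDL, hDΦ⟩ := exists_isLeibniz_coeff_one (Φ i) (hΦ i)
    rw [← hDΦ, hD R D f hDL]
    simp [hDΦ, hΦx]
  have := le_testIdeal p Φ hΦ φ hφ hφ1 f hc
  simpa only [hcoeff] using this

include p in
theorem krullDimLE_zero_quotient [IsNoetherianRing R] [IsDomain R] {f : R} (hf0 : f ≠ 0) (hf : HasIsolatedSingularity f) :
    Ring.KrullDimLE 0 (R ⧸ Ideal.span (insert f (Set.range fun i => d i f))) := by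
  refine Ring.KrullDimLE.mk₀ fun Q hQ => ?_
  have hmk : Function.Surjective
    (Ideal.Quotient.mk (Ideal.span (insert f (Set.range fun i => d i f)))) :=
    Ideal.Quotient.mk_surjective
  have hcomap : (Q.comap (Ideal.Quotient.mk
      (Ideal.span (insert f (Set.range fun i => d i f))))).IsMaximal := by
    refine isMaximal_of_jacobian_le p x d hD hf0 hf _ ?_
    conv_lhs => rw [← Ideal.mk_ker (I := Ideal.span (insert f (Set.range fun i => d i f)))]
    exact Ideal.comap_mono bot_le
  rw [← Ideal.map_comap_of_surjective _ hmk Q]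
  refine (Ideal.map_eq_top_or_isMaximal_of_surjective _ hmk hcomap).resolve_left ?_
  rw [Ideal.map_comap_of_surjective _ hmk Q]
  exact hQ.ne_top

end Main

/-! ### Decomposition of power series over their `p`-th powers -/

section PowerSeries

open MvPowerSeries

variable {k : Type u} [Field k] (p : ℕ) [hp : Fact p.Prime] [CharP k p] {n : ℕ}

omit hp in
theorem charP_mvPowerSeries : CharP (MvPowerSeries (Fin n) k) p :=
  charP_of_injective_ringHom (f := (C : k →+* MvPowerSeries (Fin n) k))
    (RingHom.injective (C : k →+* MvPowerSeries (Fin n) k)) p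

theorem coeff_nsmul_pow (s : MvPowerSeries (Fin n) k) (m : Fin n →₀ ℕ) :
    coeff (p • m) (s ^ p) = (coeff m s) ^ p := by
  have : ExpChar k p := ExpChar.prime hp.out
  rw [← map_frobenius_expand p hp.out.ne_zero, coeff_map, coeff_expand_smul, frobenius_def]

theorem coeff_pow_of_not_dvd (s : MvPowerSeries (Fin n) k) {m : Fin n →₀ ℕ} {i : Fin n}
    (h : ¬ p ∣ m i) : coeff m (s ^ p) = 0 := by
  have : ExpChar k p := ExpChar.prime hp.out
  rw [← map_frobenius_expand p hp.out.ne_zero, coeff_map, coeff_expand_of_not_dvd p _ _ h, map_zero]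

omit hp [CharP k p] in
theorem exists_nsmul_eq_of_dvd {m : Fin n →₀ ℕ} (h : ∀ i, p ∣ m i) : ∃ m' : Fin n →₀ ℕ,
    p • m' = m :=
  ⟨m.mapRange (· / p) (Nat.zero_div p), Finsupp.ext fun i => by simp [Nat.mul_div_cancel' (h i)]⟩

variable [PerfectRing k p]

/-- The power series whose coefficients are the `p`-th roots of the coefficients of `f` at the
exponents congruent to `a` modulo `p`. -/
noncomputable def frobeniusComponent (a : Fin n →₀ ℕ) :
    MvPowerSeries (Fin n) k →+ MvPowerSeries (Fin n) k where
  toFun f := fun m => (frobeniusEquiv k p).symm (coeff (p • m + a) f)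
  map_zero' := funext fun m => by
    rw [map_zero, map_zero]; rfl
  map_add' f g := funext fun m => by
    rw [map_add, map_add]; rfl

theorem coeff_frobeniusComponent (a m : Fin n →₀ ℕ) (f : MvPowerSeries (Fin n) k) :
    coeff m (frobeniusComponent p a f) = (frobeniusEquiv k p).symm (coeff (p • m + a) f) := rfl

theorem frobeniusComponent_mul_pow (r s : MvPowerSeries (Fin n) k) :
    frobeniusComponent p 0 (r * s ^ p) = s * frobeniusComponent p 0 r := by
  classical
  ext m
  rw [mul_comm, coeff_frobeniusComponent, add_zero, coeff_mul, coeff_mul, map_sum]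
  symm
  refine Finset.sum_of_injOn (fun b => (p • b.1, p • b.2)) ?_ ?_ ?_ ?_
  · rintro ⟨a, b⟩ _ ⟨a', b'⟩ _ h
    simp only [Prod.mk.injEq] at h
    exact Prod.ext (nsmul_right_injective hp.out.ne_zero h.1)
      (nsmul_right_injective hp.out.ne_zero h.2)
  · rintro ⟨a, b⟩ h
    have h' : a + b = m := Finset.HasAntidiagonal.mem_antidiagonal.mp h
    exact Finset.HasAntidiagonal.mem_antidiagonal.mpr (by rw [← smul_add, h'])
  · rintro ⟨a, b⟩ h hab
    rw [map_mul]
    -- Only exponents divisible by `p` occur in `s^p`; since the total exponent is `p • m`, the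
    -- complementary exponent is then divisible by `p` too.
    by_cases ha : ∀ i, p ∣ a i
    · obtain ⟨a', rfl⟩ := exists_nsmul_eq_of_dvd p ha
      have hsum : p • a' + b = p • m := Finset.HasAntidiagonal.mem_antidiagonal.mp h
      have hb : ∀ i, p ∣ b i := by
        intro i
        have h1 : p * a' i + b i = p * m i := by
          simpa using DFunLike.congr_fun hsum i
        exact (Nat.dvd_add_right (Dvd.intro _ rfl)).mp (h1 ▸ Dvd.intro _ rfl)
      obtain ⟨b', rfl⟩ := exists_nsmul_eq_of_dvd p hb
      refine absurd ⟨(a', b'), ?_, rfl⟩ hab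
      rw [← smul_add] at hsum
      exact Finset.HasAntidiagonal.mem_antidiagonal.mpr
        (nsmul_right_injective hp.out.ne_zero hsum)
    · push Not at ha
      obtain ⟨i, hi⟩ := ha
      rw [coeff_pow_of_not_dvd p s hi, map_zero, zero_mul]
  · rintro ⟨a, b⟩ _
    rw [map_mul, coeff_nsmul_pow, coeff_frobeniusComponent, add_zero,
      frobeniusEquiv_symm_pow]

theorem frobeniusComponent_one : frobeniusComponent p 0 (1 : MvPowerSeries (Fin n) k) = 1 := by
  classical
  ext m
  rw [coeff_frobeniusComponent, add_zero, coeff_one, coeff_one]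
  have : p • m = 0 ↔ m = 0 := by
    simp [hp.out.ne_zero]
  simp only [this]
  split_ifs <;> simp

/-- Exponents are sorted by residue modulo `p`, and perfectness supplies `p`-th roots of
coefficients. The sum is finite, which lets a derivation with no continuity assumption be computed
on power series. -/
theorem eq_sum_monomial_mul_pow (f : MvPowerSeries (Fin n) k) :
    f = ∑ a : Fin n → Fin p, monomial (Finsupp.equivFunOnFinite.symm fun i => (a i : ℕ)) 1 *
      (frobeniusComponent p (Finsupp.equivFunOnFinite.symm fun i => (a i : ℕ)) f) ^ p := by
  classical
  ext l
  rw [map_sum, Finset.sum_eq_single fun i => ⟨l i % p, Nat.mod_lt _ hp.out.pos⟩]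
  · set b : Fin n →₀ ℕ := Finsupp.equivFunOnFinite.symm fun i => l i % p
    set m : Fin n →₀ ℕ := l.mapRange (· / p) (Nat.zero_div p)
    have hl : l = b + p • m := Finsupp.ext fun i => by simp [b, m, Nat.mod_add_div]
    conv_rhs => rw [hl]
    rw [coeff_add_monomial_mul, one_mul, coeff_nsmul_pow, coeff_frobeniusComponent,
      frobeniusEquiv_symm_pow_p, add_comm, ← hl]
  · intro a _ ha
    rw [coeff_monomial_mul, one_mul]
    split_ifs with hle
    · obtain ⟨i, hi⟩ : ∃ i, l i % p ≠ a i := by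
        by_contra! h
        exact ha (funext fun i => Fin.ext (h i).symm)
      refine coeff_pow_of_not_dvd p _ (i := i) fun hdvd => hi ?_
      have hle' : (a i : ℕ) ≤ l i := hle i
      have hdvd' : p ∣ l i - a i := hdvd
      rw [← (Nat.modEq_iff_dvd' hle').mpr hdvd', Nat.mod_eq_of_lt (a i).2]
    · rfl
  · simp

end PowerSeries

/-! ### The chain rule for additive Leibniz maps -/

section Derivations

variable {k : Type u} [Field k] (p : ℕ) [hp : Fact p.Prime] [CharP k p] [PerfectRing k p] {n : ℕ}

include p in
theorem derivation_aeval {S M : Type*} [CommRing S] [Algebra k S] [CharP S p] [AddCommGroup M]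
    [Module S M] {ι : Type*} [Fintype ι] [DecidableEq ι] (x : ι → S) (d : ι → Derivation k S S)
    (hd : ∀ i j, d i (x j) = if i = j then 1 else 0) {D : S →+ M} (hD : IsLeibniz D)
    (f : MvPolynomial ι k) {y : S} (hy : MvPolynomial.aeval x f = y) :
    D y = ∑ i, d i y • D (x i) := by
  subst hy
  induction f using MvPolynomial.induction_on with
  | C c =>
    -- Every constant is a `p`-th power, so `D` kills it without any assumption of `k`-linearity.
    obtain ⟨b, rfl⟩ := (frobeniusEquiv k p).surjective c
    have h : D (algebraMap k S (frobeniusEquiv k p b)) = 0 := by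
      rw [frobeniusEquiv_apply, frobenius_def, map_pow, hD.pow_char p]
    simp only [MvPolynomial.aeval_C, h, Derivation.map_algebraMap, zero_smul,
      Finset.sum_const_zero]
  | add f g hf hg => simp [hf, hg, add_smul, Finset.sum_add_distrib]
  | mul_X f j hf =>
    simp only [map_mul, MvPolynomial.aeval_X, Derivation.leibniz, hD _ _, hf, smul_eq_mul, add_smul,
      Finset.sum_add_distrib, hd]
    congr 1
    · simp
    · rw [Finset.smul_sum]
      simp only [mul_smul]

include p in
theorem mvPolynomial_derivation_apply (M : Type*) [AddCommGroup M]
    [Module (MvPolynomial (Fin n) k) M] (D : MvPolynomial (Fin n) k →+ M)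
    (f : MvPolynomial (Fin n) k) (hD : IsLeibniz D) :
    D f = ∑ i, MvPolynomial.pderiv i f • D (MvPolynomial.X i) := by
  exact derivation_aeval p (MvPolynomial.X : Fin n → MvPolynomial (Fin n) k)
    (fun i => MvPolynomial.pderiv i) (fun i j => by
      simp [MvPolynomial.pderiv_X, Pi.single_apply, eq_comm]) hD f (MvPolynomial.aeval_X_left_apply f)

include p in
theorem mvPowerSeries_derivation_apply (M : Type*) [AddCommGroup M]
    [Module (MvPowerSeries (Fin n) k) M] (D : MvPowerSeries (Fin n) k →+ M)
    (f : MvPowerSeries (Fin n) k) (hD : IsLeibniz D) :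
    D f = ∑ i, MvPowerSeries.pderiv k i f • D (MvPowerSeries.X i) := by
  have := charP_mvPowerSeries (k := k) (n := n) p
  have hmul : ∀ a g : MvPowerSeries (Fin n) k,
      D a = ∑ i, MvPowerSeries.pderiv k i a • D (MvPowerSeries.X i) →
      D (a * g ^ p) = ∑ i, MvPowerSeries.pderiv k i (a * g ^ p) • D (MvPowerSeries.X i) := by
    intro a g ha
    have h0 : ∀ i, MvPowerSeries.pderiv k i (g ^ p) = 0 := fun i => by
      rw [MvPowerSeries.pderiv_pow, CharP.cast_eq_zero, zero_mul, zero_mul]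
    simp only [Derivation.leibniz, hD _ _, hD.pow_char p, h0, smul_zero, mul_zero, zero_add, ha,
      Finset.smul_sum, smul_eq_mul, mul_smul]
  have hmon : ∀ m : Fin n →₀ ℕ, D (MvPowerSeries.monomial m 1) =
      ∑ i, MvPowerSeries.pderiv k i (MvPowerSeries.monomial m 1) • D (MvPowerSeries.X i) := by
    intro m
    refine derivation_aeval p (MvPowerSeries.X : Fin n → MvPowerSeries (Fin n) k)
      (fun i => MvPowerSeries.pderiv k i) (fun i j => by
        simp [MvPowerSeries.pderiv_X, Pi.single_apply, eq_comm]) hD (MvPolynomial.monomial m 1) ?_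
    rw [MvPolynomial.aeval_monomial, map_one, one_mul]
    exact (by rw [MvPowerSeries.monomial_eq', map_one, one_mul] :
      MvPowerSeries.monomial m (1 : k) = m.prod fun j e => MvPowerSeries.X j ^ e).symm
  rw [eq_sum_monomial_mul_pow p f]
  simp only [map_sum, Finset.sum_smul]
  rw [Finset.sum_comm]
  exact Finset.sum_congr rfl fun a _ => hmul _ _ (hmon _)

end Derivations

/-! ### Taylor expansion along one coordinate -/

section Taylor

variable (k : Type u) [Field k] {n : ℕ}

/-- The substitution `X i ↦ X i + t`. -/
noncomputable def polyTaylor (i : Fin n) :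
    MvPolynomial (Fin n) k →+* PowerSeries (MvPolynomial (Fin n) k) :=
  MvPolynomial.eval₂Hom (PowerSeries.C.comp MvPolynomial.C)
    fun j => PowerSeries.C (MvPolynomial.X j) + if j = i then PowerSeries.X else 0

theorem coeff_zero_polyTaylor (i : Fin n) (r : MvPolynomial (Fin n) k) :
    PowerSeries.coeff 0 (polyTaylor k i r) = r := by
  have : PowerSeries.constantCoeff.comp (polyTaylor k i) = RingHom.id _ := by
    refine MvPolynomial.ringHom_ext (fun c => ?_) fun j => ?_
    · simp [polyTaylor]
    · simp [polyTaylor]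
      split_ifs <;> simp
  rw [PowerSeries.coeff_zero_eq_constantCoeff_apply]
  exact RingHom.congr_fun this r

theorem coeff_one_polyTaylor_X (i j : Fin n) :
    PowerSeries.coeff 1 (polyTaylor k i (MvPolynomial.X j)) = if j = i then 1 else 0 := by
  simp only [polyTaylor, MvPolynomial.coe_eval₂Hom, MvPolynomial.eval₂_X, map_add,
    PowerSeries.coeff_C, one_ne_zero, if_false, zero_add]
  split_ifs <;> simp

theorem hasSubst_add_X_none (i : Fin n) : MvPowerSeries.HasSubst
    fun j => (MvPowerSeries.X (some j) + if j = i then MvPowerSeries.X none else 0 :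
      MvPowerSeries (Option (Fin n)) k) :=
  MvPowerSeries.hasSubst_of_constantCoeff_zero fun j => by split_ifs <;> simp

/-- The substitution `X i ↦ X i + t`. -/
noncomputable def seriesTaylor (i : Fin n) :
    MvPowerSeries (Fin n) k →+* PowerSeries (MvPowerSeries (Fin n) k) :=
  ((MvPowerSeries.optionEquivLeft (Fin n) k).toAlgHom.comp
    (MvPowerSeries.substAlgHom (R := k) (hasSubst_add_X_none k i))).toRingHom

theorem seriesTaylor_apply (i : Fin n) (f : MvPowerSeries (Fin n) k) : seriesTaylor k i f =
    MvPowerSeries.optionEquivLeft (Fin n) k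
      (MvPowerSeries.substAlgHom (R := k) (hasSubst_add_X_none k i) f) := rfl

theorem seriesTaylor_X (i j : Fin n) : seriesTaylor k i (MvPowerSeries.X j) =
    PowerSeries.C (MvPowerSeries.X j) + if j = i then PowerSeries.X else 0 := by
  rw [seriesTaylor_apply, MvPowerSeries.substAlgHom_X]
  split_ifs <;> simp

theorem coeff_zero_seriesTaylor (i : Fin n) (r : MvPowerSeries (Fin n) k) :
    PowerSeries.coeff 0 (seriesTaylor k i r) = r := by
  classical
  have hmon : ∀ m : Fin n →₀ ℕ, PowerSeries.coeff 0
      (seriesTaylor k i (MvPowerSeries.monomial m 1)) = MvPowerSeries.monomial m 1 := by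
    intro m
    have hm : MvPowerSeries.monomial m (1 : k) = m.prod fun j e => MvPowerSeries.X j ^ e := by
      rw [MvPowerSeries.monomial_eq', map_one, one_mul]
    rw [hm, PowerSeries.coeff_zero_eq_constantCoeff_apply, map_finsuppProd, map_finsuppProd]
    refine Finsupp.prod_congr fun j _ => ?_
    rw [map_pow, map_pow, seriesTaylor_X]
    split_ifs <;> simp
  ext m
  have hcoeff : ∀ f, MvPowerSeries.coeff m (PowerSeries.coeff 0 (seriesTaylor k i f)) =
      MvPowerSeries.coeff (m.optionElim 0) (MvPowerSeries.subst (fun j =>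
        (MvPowerSeries.X (some j) + if j = i then MvPowerSeries.X none else 0 :
          MvPowerSeries (Option (Fin n)) k)) f) := by
    intro f
    rw [seriesTaylor_apply, MvPowerSeries.coeff_coeff_optionEquivLeft,
      MvPowerSeries.substAlgHom_apply]
  rw [hcoeff, MvPowerSeries.coeff_subst (hasSubst_add_X_none k i)]
  have hterm : ∀ d : Fin n →₀ ℕ, MvPowerSeries.coeff (m.optionElim 0) (d.prod fun j e =>
      (MvPowerSeries.X (some j) + if j = i then MvPowerSeries.X none else 0 :
          MvPowerSeries (Option (Fin n)) k) ^ e) = if m = d then 1 else 0 := by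
    intro d
    -- The coefficient formula is read backwards on a monomial, where multiplicativity already gives
    -- the answer; the infinite sum for a general series then reduces to one term.
    have h := hcoeff (MvPowerSeries.monomial d 1)
    rw [hmon, MvPowerSeries.coeff_monomial,
      MvPowerSeries.subst_monomial (hasSubst_add_X_none k i), map_one, one_mul] at h
    exact h.symm
  simp only [hterm]
  rw [finsum_eq_single _ m fun d hd => by rw [if_neg hd.symm, smul_zero]]
  simp

theorem coeff_one_seriesTaylor_X (i j : Fin n) :
    PowerSeries.coeff 1 (seriesTaylor k i (MvPowerSeries.X j)) = if j = i then 1 else 0 := by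
  rw [seriesTaylor_X, map_add, PowerSeries.coeff_C]
  split_ifs <;> simp_all

end Taylor

/-! ### Frobenius splitting of polynomials, finiteness, and conclusions -/

section Results

variable {k : Type u} [Field k] (p : ℕ) [hp : Fact p.Prime] [CharP k p] [PerfectRing k p] {n : ℕ}

/-- The restriction of `frobeniusComponent p 0` to polynomials. -/
theorem exists_polynomial_coe_eq_frobeniusComponent (f : MvPolynomial (Fin n) k) :
    ∃ g : MvPolynomial (Fin n) k, (g : MvPowerSeries (Fin n) k) = frobeniusComponent p 0 f := by
  classical
  have hfin : (Function.support fun m : Fin n →₀ ℕ =>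
      (frobeniusEquiv k p).symm (MvPolynomial.coeff (p • m) f)).Finite := by
    refine (f.support.finite_toSet.preimage
      (nsmul_right_injective (M := Fin n →₀ ℕ) hp.out.ne_zero).injOn).subset fun m hm => ?_
    simpa using hm
  refine ⟨∑ m ∈ hfin.toFinset, MvPolynomial.monomial m
    ((frobeniusEquiv k p).symm (MvPolynomial.coeff (p • m) f)), ?_⟩
  ext m
  rw [MvPolynomial.coeff_coe, coeff_frobeniusComponent, add_zero, MvPolynomial.coeff_coe,
    MvPolynomial.coeff_sum]
  simp only [MvPolynomial.coeff_monomial]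
  rw [Finset.sum_ite_eq']
  split_ifs with h
  · rfl
  · simpa [eq_comm] using h

theorem exists_frobenius_splitting_mvPolynomial :
    ∃ φ : MvPolynomial (Fin n) k →+ MvPolynomial (Fin n) k,
      (∀ r s, φ (r * s ^ p) = s * φ r) ∧ φ 1 = 1 := by
  choose φ hφ using exists_polynomial_coe_eq_frobeniusComponent (k := k) (n := n) p
  have hinj := MvPolynomial.coe_injective (σ := Fin n) (R := k)
  refine ⟨AddMonoidHom.mk' φ fun a b => hinj ?_, fun r s => hinj ?_, hinj ?_⟩
  · rw [MvPolynomial.coe_add, hφ, hφ, hφ, MvPolynomial.coe_add, map_add]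
  · change ((φ (r * s ^ p) : MvPolynomial (Fin n) k) : MvPowerSeries (Fin n) k) =
      ((s * φ r : MvPolynomial (Fin n) k) : MvPowerSeries (Fin n) k)
    rw [hφ, MvPolynomial.coe_mul,
      MvPolynomial.coe_mul, MvPolynomial.coe_pow, hφ, frobeniusComponent_mul_pow]
  · rw [AddMonoidHom.mk'_apply, hφ, MvPolynomial.coe_one, frobeniusComponent_one]

/-- The quotient is Artinian, and modulo its Jacobson radical each series equals its constant term,
so that residue ring is finite over `k`; finiteness then lifts to the whole quotient. -/
theorem finite_quotient_mvPowerSeries (J : Ideal (MvPowerSeries (Fin n) k))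
    [Ring.KrullDimLE 0 (MvPowerSeries (Fin n) k ⧸ J)] :
    Module.Finite k (MvPowerSeries (Fin n) k ⧸ J) := by
  set A := MvPowerSeries (Fin n) k ⧸ J
  have : IsArtinianRing A := isArtinianRing_iff_isNoetherianRing_krullDimLE_zero.mpr
    ⟨inferInstance, inferInstance⟩
  have hsurj : Function.Surjective (Algebra.linearMap k (A ⧸ Ring.jacobson A)) := by
    intro z
    obtain ⟨y, rfl⟩ := Ideal.Quotient.mk_surjective z
    obtain ⟨r, rfl⟩ := Ideal.Quotient.mk_surjective y
    refine ⟨MvPowerSeries.constantCoeff r, ?_⟩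
    have hmem : Ideal.Quotient.mk J (MvPowerSeries.C (MvPowerSeries.constantCoeff r) - r) ∈
        Ring.jacobson A := by
      rw [Ring.jacobson_eq_sInf_isMaximal, Ideal.mem_sInf]
      intro I hI
      have hI₀ : I.IsMaximal := hI
      have hI' : (I.comap (Ideal.Quotient.mk J)).IsMaximal :=
        Ideal.comap_isMaximal_of_surjective _ Ideal.Quotient.mk_surjective
      rw [← Ideal.mem_comap, IsLocalRing.eq_maximalIdeal hI', IsLocalRing.mem_maximalIdeal,
        mem_nonunits_iff, MvPowerSeries.isUnit_iff_constantCoeff]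
      simp
    have h0 := Ideal.Quotient.eq_zero_iff_mem.mpr hmem
    rw [map_sub, map_sub, sub_eq_zero] at h0
    exact h0
  have : Module.Finite k (A ⧸ Ring.jacobson A) := Module.Finite.of_surjective _ hsurj
  exact IsSemiprimaryRing.finite_of_isArtinian k A A

theorem mvPolynomial_main {f : MvPolynomial (Fin n) k} (hf0 : f ≠ 0)
    (hf : HasIsolatedSingularity f) :
    Module.Finite k (MvPolynomial (Fin n) k ⧸ polyJac f) ∧
      Set.encard {c : ℝ | c ∈ Set.Icc (0 : ℝ) 1 ∧
          IsFJumpingCoefficient p (Ideal.span {f}) c} ≤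
        ((Module.finrank k (MvPolynomial (Fin n) k ⧸ polyJac f) + 1 : ℕ) : ℕ∞) := by
  have hD : ∀ (M : Type u) [AddCommGroup M] [Module (MvPolynomial (Fin n) k) M]
      (D : MvPolynomial (Fin n) k →+ M) (r : MvPolynomial (Fin n) k), IsLeibniz D →
      D r = ∑ i, MvPolynomial.pderiv i r • D (MvPolynomial.X i) := fun M _ _ D r h =>
    mvPolynomial_derivation_apply p M D r h
  have hfin : Module.Finite k (MvPolynomial (Fin n) k ⧸ polyJac f) :=
    (Module.finite_iff_krullDimLE_zero k _).mpr (krullDimLE_zero_quotient p _ _ hD hf0 hf)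
  obtain ⟨φ, hφ, hφ1⟩ := exists_frobenius_splitting_mvPolynomial (k := k) (n := n) p
  exact ⟨hfin, encard_jumping_le_of_taylor p _ _ hD (polyTaylor k) (coeff_zero_polyTaylor k)
    (coeff_one_polyTaylor_X k) φ hφ hφ1 f hfin⟩

theorem mvPowerSeries_main {f : MvPowerSeries (Fin n) k} (hf0 : f ≠ 0)
    (hf : HasIsolatedSingularity f) :
    Module.Finite k (MvPowerSeries (Fin n) k ⧸ seriesJac f) ∧
      Set.encard {c : ℝ | c ∈ Set.Icc (0 : ℝ) 1 ∧
          IsFJumpingCoefficient p (Ideal.span {f}) c} ≤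
        ((Module.finrank k (MvPowerSeries (Fin n) k ⧸ seriesJac f) + 1 : ℕ) : ℕ∞) := by
  have := charP_mvPowerSeries (k := k) (n := n) p
  have : IsDomain (MvPowerSeries (Fin n) k) := NoZeroDivisors.to_isDomain _
  have hD : ∀ (M : Type u) [AddCommGroup M] [Module (MvPowerSeries (Fin n) k) M]
      (D : MvPowerSeries (Fin n) k →+ M) (r : MvPowerSeries (Fin n) k), IsLeibniz D →
      D r = ∑ i, MvPowerSeries.pderiv k i r • D (MvPowerSeries.X i) := fun M _ _ D r h =>
    mvPowerSeries_derivation_apply p M D r h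
  have : Ring.KrullDimLE 0 (MvPowerSeries (Fin n) k ⧸ seriesJac f) :=
    krullDimLE_zero_quotient p _ _ hD hf0 hf
  have hfin := finite_quotient_mvPowerSeries (seriesJac f)
  exact ⟨hfin, encard_jumping_le_of_taylor p _ _ hD (seriesTaylor k) (coeff_zero_seriesTaylor k)
    (coeff_one_seriesTaylor_X k) (frobeniusComponent p 0) (frobeniusComponent_mul_pow p)
    (frobeniusComponent_one p) f hfin⟩

end Results

end FJump

theorem mainTheorem2 {k : Type*} [Field k] [PerfectField k] (p : ℕ) (hp : p.Prime) [CharP k p]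
    (n : ℕ) :
    (∀ f : MvPolynomial (Fin n) k, f ≠ 0 → FJump.HasIsolatedSingularity f →
      Module.Finite k (MvPolynomial (Fin n) k ⧸ FJump.polyJac f) ∧
      Set.encard {c : ℝ | c ∈ Set.Icc (0 : ℝ) 1 ∧
          FJump.IsFJumpingCoefficient p (Ideal.span {f}) c} ≤
        ((Module.finrank k (MvPolynomial (Fin n) k ⧸ FJump.polyJac f) + 1 : ℕ) : ℕ∞)) ∧
    (∀ f : MvPowerSeries (Fin n) k, f ≠ 0 → FJump.HasIsolatedSingularity f →
      Module.Finite k (MvPowerSeries (Fin n) k ⧸ FJump.seriesJac f) ∧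
      Set.encard {c : ℝ | c ∈ Set.Icc (0 : ℝ) 1 ∧
          FJump.IsFJumpingCoefficient p (Ideal.span {f}) c} ≤
        ((Module.finrank k (MvPowerSeries (Fin n) k ⧸ FJump.seriesJac f) + 1 : ℕ) : ℕ∞)) := by
  have : Fact p.Prime := ⟨hp⟩
  have : PerfectRing k p := PerfectField.toPerfectRing p
  exact ⟨fun f hf0 hf => FJump.mvPolynomial_main p hf0 hf,
    fun f hf0 hf => FJump.mvPowerSeries_main p hf0 hf⟩
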